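/- Let $n, d \ge 1$ be integers and let $V$ be a random $d \times n$ real matrix whose entries are independent (not necessarily identically distributed), each having a distribution that has a density with respect to Lebesgue measure on $\mathbb{R}$ and is symmetric about $0$. Let $\mathcal{S} \subseteq \{0,1\}^n$ be an arbitrary set, and let $X = \{Vr : r \in \mathcal{S}\} \subseteq \mathbb{R}^d$. For $a,b\in\mathbb{R}^d$ say that $b$ dominates $a$ if $b_i \ge a_i$ for all $i$ and $b_i > a_i$ for at least one $i$, and let $p(X)$ be the number of Pareto optima of $X$, i.e. of points of $X$ that are not dominated by any point of $X$. Then $$\mathbb{E}_V\, p(X) \;\ge\; \frac{|\mathcal{S}|}{2^{\,n+d-1}} \sum_{k=0}^{d-1} \binom{n-1}{k}.$$ -/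

import Mathlib

open MeasureTheory ProbabilityTheory
open scoped Matrix

namespace SmoothedPareto

/-- The set `{0,1}^n` inside `ℝ^n`. -/
def zeroOneCube (n : ℕ) : Set (Fin n → ℝ) :=
  {x | ∀ j, x j = 0 ∨ x j = 1}

/-- `b` dominates `a`: `b` is at least as large in every coordinate and strictly larger in at
least one. -/
def Dominates {d : ℕ} (b a : Fin d → ℝ) : Prop :=
  (∀ i, a i ≤ b i) ∧ ∃ i, a i < b i

/-- The Pareto optima of a set of points `X`: the points of `X` that no point of `X` dominates. -/
def paretoOptima {d : ℕ} (X : Set (Fin d → ℝ)) : Set (Fin d → ℝ) :=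
  {x | x ∈ X ∧ ∀ y ∈ X, ¬ Dominates y x}

/-- The number `p(X)` of Pareto optima of a (finite) set of points `X`. -/
noncomputable def paretoCount {d : ℕ} (X : Set (Fin d → ℝ)) : ℕ :=
  (paretoOptima X).ncard

/-- The set `{V r : r ∈ S}` of objective vectors of the feasible solutions. -/
def objectiveVectors {d n : ℕ} (V : Matrix (Fin d) (Fin n) ℝ) (S : Set (Fin n → ℝ)) :
    Set (Fin d → ℝ) :=
  {x | ∃ r ∈ S, x = V *ᵥ r}

end SmoothedPareto

namespace SmoothedPareto

/-! For `r ∈ S`, switch the sign of column `j` when `r j = 1`. If some positive weighting of the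
rows is negative on every switched column, then `r` is the unique maximizer of that weighted
objective over the cube, so `V r` is Pareto optimal and shared with no other point
(`card_separable_le_paretoCount`). Symmetry makes this event equally likely for all `r`, so it
suffices to bound the probability `p` that `V` itself is `separable`.

Average over the `2 ^ (n + d - 1)` switchings of rows and columns that fix the first column: each
preserves the law of `V`, so `p` is the expected fraction of switchings that give a separable
matrix. Almost surely any `d` or fewer columns are independent, and then the count is bounded
deterministically (`sum_choose_le_card_flips`). Row switchings turn positive weights into weights of
arbitrary nonzero signs, so what is counted is column sign patterns realized by a linear functional.
These strongly shatter every set of fewer than `d` of the remaining `n - 1` columns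
(`exists_weights_of_linearIndepOn`), and a family is at least as large as the collection it strongly
shatters. -/

/-! ### Strong shattering -/

/-- A reverse Sauer inequality: a family has at least as many members as it strongly shatters
sets. -/
theorem card_le_card_of_stronglyShatters {α : Type*} [Fintype α] [DecidableEq α]
    (𝒜 ℬ : Finset (Finset α))
    (h : ∀ J ∈ ℬ, ∃ u : Finset α, ∀ t ⊆ J, u \ J ∪ t ∈ 𝒜) : ℬ.card ≤ 𝒜.card := by
  -- If `𝒜ᶜ` shattered `Jᶜ`, some `w ∉ 𝒜` would have trace `u \ J` there, yet `w = u \ J ∪ (w ∩ J)`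
  -- lies in `𝒜`. Pajor's bound for `𝒜ᶜ` then gives the claim by complementation.
  have hsub : 𝒜ᶜ.shatterer ⊆ (ℬ.image compl)ᶜ := by
    intro K hK
    rw [Finset.mem_shatterer] at hK
    rw [Finset.mem_compl, Finset.mem_image]
    rintro ⟨J, hJ, rfl⟩
    obtain ⟨u, hu⟩ := h J hJ
    obtain ⟨w, hw, hwu⟩ := @hK (u \ J) (by intro x; simp)
    refine Finset.mem_compl.1 hw ?_
    have : w = u \ J ∪ (w ∩ J) := by
      rw [← hwu]
      ext x
      simp only [Finset.mem_union, Finset.mem_inter, Finset.mem_compl]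
      tauto
    rw [this]
    exact hu _ Finset.inter_subset_right
  have h1 := (Finset.card_le_card_shatterer 𝒜ᶜ).trans (Finset.card_le_card hsub)
  rw [Finset.card_compl, Finset.card_compl, Finset.card_image_of_injective _ compl_injective] at h1
  have h2 := Finset.card_le_univ 𝒜
  have h3 := Finset.card_le_univ ℬ
  omega

theorem card_filter_card_lt {α : Type*} [Fintype α] [DecidableEq α] (d : ℕ) :
    (Finset.univ.filter fun J : Finset α => J.card < d).card =
      ∑ k ∈ Finset.range d, (Fintype.card α).choose k := by
  rw [Finset.card_eq_sum_card_fiberwise (f := Finset.card) (t := Finset.range d)]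
  · refine Finset.sum_congr rfl fun k hk => ?_
    rw [← Finset.card_univ, ← Finset.card_powersetCard]
    congr 1
    ext J
    simp only [Finset.mem_filter, Finset.mem_univ, true_and, Finset.mem_powersetCard,
      Finset.subset_univ, and_iff_right_iff_imp]
    rintro rfl
    exact Finset.mem_range.1 hk
  · intro J hJ
    simpa using hJ

/-! ### Genericity of the columns -/

/-- A nonzero polynomial almost surely does not vanish at a point with independent atomless
coordinates. -/
theorem ae_pi_mvPolynomial_eval_ne_zero {N : ℕ} (μ : Fin N → Measure ℝ)
    [∀ i, IsProbabilityMeasure (μ i)] [∀ i, NullSingletonClass (μ i)] (p : MvPolynomial (Fin N) ℝ)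
    (hp : p ≠ 0) : ∀ᵐ x ∂Measure.pi μ, MvPolynomial.eval x p ≠ 0 := by
  induction N with
  | zero =>
    refine Filter.Eventually.of_forall fun x hx => hp ?_
    refine MvPolynomial.funext fun y => ?_
    rw [Subsingleton.elim y x, hx, map_zero]
  | succ N ih =>
    have hmeas : MeasurableSet
        {z : ℝ × (Fin N → ℝ) | MvPolynomial.eval (Fin.cons z.1 z.2 : Fin (N + 1) → ℝ) p ≠ 0} := by
      refine (IsOpen.measurableSet ?_)
      refine isOpen_ne.preimage ((MvPolynomial.continuous_eval p).comp ?_)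
      refine continuous_pi fun i => ?_
      refine Fin.cases ?_ (fun j => ?_) i
      · exact continuous_fst
      · exact (continuous_apply j).comp continuous_snd
    have key : ∀ᵐ z ∂(μ 0).prod (Measure.pi fun j => μ (Fin.succ j)),
        MvPolynomial.eval (Fin.cons z.1 z.2 : Fin (N + 1) → ℝ) p ≠ 0 := by
      -- With the tail chosen first, the leading coefficient in the head variable is almost surely
      -- nonzero by induction, leaving finitely many roots for the head.
      rw [Measure.ae_prod_iff_ae_ae hmeas, Measure.ae_ae_comm hmeas]
      set q := MvPolynomial.finSuccEquiv ℝ N p with hq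
      have hq0 : q ≠ 0 := by simpa [hq] using hp
      have hlead : q.leadingCoeff ≠ 0 := Polynomial.leadingCoeff_ne_zero.2 hq0
      filter_upwards [ih (fun j => μ (Fin.succ j)) q.leadingCoeff hlead] with y hy
      have hmap : q.map (MvPolynomial.eval y) ≠ 0 := by
        intro h0
        apply hy
        have := congrArg (fun f => Polynomial.coeff f q.natDegree) h0
        simpa using this
      have hfin : {x : ℝ | (q.map (MvPolynomial.eval y)).eval x = 0}.Finite :=
        (q.map (MvPolynomial.eval y)).rootSet_finite ℝ |>.subset fun x hx => by
          rw [Polynomial.mem_rootSet]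
          exact ⟨hmap, by simpa using hx⟩
      have hnull := hfin.measure_zero (μ 0)
      rw [ae_iff]
      simpa [MvPolynomial.eval_eq_eval_mv_eval', hq] using hnull
    have hmp := measurePreserving_piFinSuccAbove μ 0
    have := hmp.quasiMeasurePreserving.ae key
    filter_upwards [this] with x hx
    convert hx using 3
    exact (Fin.cons_self_tail x).symm

theorem ae_mvPolynomial_eval_ne_zero_of_iIndepFun {Ω ι : Type*} [MeasurableSpace Ω] [Fintype ι]
    {P : Measure Ω} [IsProbabilityMeasure P] {X : ι → Ω → ℝ} (hX : ∀ i, AEMeasurable (X i) P)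
    (hindep : iIndepFun X P) (hatom : ∀ i, NullSingletonClass (P.map (X i)))
    (p : MvPolynomial ι ℝ) (hp : p ≠ 0) :
    ∀ᵐ ω ∂P, MvPolynomial.eval (fun i => X i ω) p ≠ 0 := by
  classical
  let e := Fintype.equivFin ι
  have hind : iIndepFun (fun k => X (e.symm k)) P := hindep.precomp e.symm.injective
  have hmap := (iIndepFun_iff_map_fun_eq_pi_map fun k => hX (e.symm k)).1 hind
  have : ∀ k, IsProbabilityMeasure (P.map (X (e.symm k))) := fun k =>
    Measure.isProbabilityMeasure_map (hX _)
  have hp' : MvPolynomial.rename e p ≠ 0 := by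
    rwa [Ne, map_eq_zero_iff _ (MvPolynomial.rename_injective _ e.injective)]
  have h := ae_pi_mvPolynomial_eval_ne_zero (fun k => P.map (X (e.symm k))) _ hp'
  rw [← hmap] at h
  have := ae_of_ae_map (aemeasurable_pi_lambda _ fun k => hX (e.symm k)) h
  filter_upwards [this] with ω hω
  rw [MvPolynomial.eval_rename] at hω
  convert hω using 2
  congr 1
  funext i
  simp

/-- Any at most `d` columns of a `d`-rowed matrix with independent atomless entries are almost
surely linearly independent. -/
theorem ae_linearIndepOn_col {Ω κ : Type*} [MeasurableSpace Ω] {d : ℕ} [Fintype κ]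
    [DecidableEq κ]
    {P : Measure Ω} [IsProbabilityMeasure P] {X : Fin d × κ → Ω → ℝ}
    (hX : ∀ i, AEMeasurable (X i) P)
    (hindep : iIndepFun X P) (hatom : ∀ i, NullSingletonClass (P.map (X i))) :
    ∀ᵐ ω ∂P, ∀ J : Finset κ, J.card ≤ d →
      LinearIndepOn ℝ (fun j i => X (i, j) ω) (J : Set κ) := by
  rw [ae_all_iff]
  intro J
  by_cases hJ : J.card ≤ d
  swap
  · exact Filter.Eventually.of_forall fun ω h => absurd h hJ
  obtain ⟨g⟩ : Nonempty (J ↪ Fin d) :=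
    Function.Embedding.nonempty_of_card_le (by simpa using hJ)
  let A : Matrix J J (MvPolynomial (Fin d × κ) ℝ) := fun a b => MvPolynomial.X (g a, (b : κ))
  have heval : ∀ x : Fin d × κ → ℝ, MvPolynomial.eval x A.det =
      (Matrix.of fun a b : J => x (g a, (b : κ))).det := by
    intro x
    rw [RingHom.map_det]
    congr 1
    ext a b
    exact MvPolynomial.eval_X _
  have hA : A.det ≠ 0 := by
    intro h0
    -- The determinant polynomial is nonzero because this 0/1 specialization makes the minor the
    -- identity.
    have h1 := heval fun z => if ∃ a : J, z = (g a, (a : κ)) then 1 else 0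
    rw [h0, map_zero] at h1
    have h2 : (Matrix.of fun a b : J =>
        (if ∃ c : J, ((g a, (b : κ)) : Fin d × κ) = (g c, (c : κ)) then (1 : ℝ) else 0)) = 1 := by
      ext a b
      rw [Matrix.of_apply, Matrix.one_apply]
      refine if_congr ?_ rfl rfl
      constructor
      · rintro ⟨c, hc⟩
        rw [Prod.mk.injEq] at hc
        rw [g.injective hc.1]
        exact Subtype.ext hc.2.symm
      · rintro rfl
        exact ⟨a, rfl⟩
    rw [h2, Matrix.det_one] at h1
    exact zero_ne_one h1
  filter_upwards [ae_mvPolynomial_eval_ne_zero_of_iIndepFun hX hindep hatom _ hA] with ω hω _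
  rw [heval] at hω
  have h3 := Matrix.linearIndependent_cols_of_det_ne_zero hω
  exact LinearIndependent.of_comp (LinearMap.funLeft ℝ ℝ g) h3

/-! ### Sign patterns realized by functionals -/

open Filter Topology in
/-- Suppose that the vectors indexed by `J` remain linearly independent when any one further vector
is added. Then there are signs `c`, positive at `j₀`, such that every sign pattern `c'` agreeing
with `c` off `J` is realized by a functional with nonzero coordinates. -/
theorem exists_weights_of_linearIndepOn {d : ℕ} {κ : Type*} [Fintype κ] [DecidableEq κ]
    (v : κ → Fin d → ℝ) (J : Finset κ)
    (hv : ∀ j ∉ J, LinearIndepOn ℝ v (insert j (J : Set κ))) (hJ : LinearIndepOn ℝ v (J : Set κ))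
    (j₀ : κ) (hj₀ : j₀ ∉ J) :
    ∃ c : κ → ℝ, c j₀ = 1 ∧ (∀ j, c j = 1 ∨ c j = -1) ∧
      ∀ c' : κ → ℝ, (∀ j, c' j = 1 ∨ c' j = -1) → (∀ j ∉ J, c' j = c j) →
        ∃ w : Fin d → ℝ, (∀ i, w i ≠ 0) ∧ ∀ j, c' j * ∑ i, w i * v j i < 0 := by
  set W := Submodule.span ℝ (v '' (J : Set κ)) with hW
  have hnot : ∀ j : {j // j ∉ J}, W.mkQ (v j) ≠ 0 := by
    rintro ⟨j, hj⟩
    rw [Submodule.mkQ_apply, Ne, Submodule.Quotient.mk_eq_zero]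
    exact ((linearIndepOn_insert (by simpa using hj)).1 (hv j hj)).2
  -- Modulo the span of `J` the other vectors are nonzero, so one functional vanishes on `J` and at
  -- none of them; its sign can be chosen to be negative at `j₀`.
  obtain ⟨f', hf'⟩ := Module.exists_dual_forall_apply_ne_zero (K := ℝ) _ hnot
  have hf0 : ∃ f : (Fin d → ℝ) →ₗ[ℝ] ℝ, (∀ j ∈ J, f (v j) = 0) ∧ (∀ j ∉ J, f (v j) ≠ 0) ∧
      f (v j₀) < 0 := by
    have hz : ∀ j ∈ J, (f' ∘ₗ W.mkQ) (v j) = 0 := by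
      intro j hj
      have : W.mkQ (v j) = 0 := by
        rw [Submodule.mkQ_apply, Submodule.Quotient.mk_eq_zero]
        exact Submodule.subset_span ⟨j, hj, rfl⟩
      rw [LinearMap.comp_apply, this, map_zero]
    have hn : ∀ j ∉ J, (f' ∘ₗ W.mkQ) (v j) ≠ 0 := fun j hj => hf' ⟨j, hj⟩
    rcases lt_or_gt_of_ne (hn j₀ hj₀) with h | h
    · exact ⟨_, hz, hn, h⟩
    · refine ⟨-(f' ∘ₗ W.mkQ), fun j hj => ?_, fun j hj => ?_, ?_⟩
      · rw [LinearMap.neg_apply, hz j hj, neg_zero]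
      · rw [LinearMap.neg_apply]
        exact neg_ne_zero.2 (hn j hj)
      · rw [LinearMap.neg_apply]
        exact neg_lt_zero.2 h
  obtain ⟨f, hfJ, hfn, hfj₀⟩ := hf0
  refine ⟨fun j => if f (v j) < 0 then 1 else -1, if_pos hfj₀, fun j => ?_, ?_⟩
  · by_cases h : f (v j) < 0 <;> simp [h]
  intro c' hc' hcc
  obtain ⟨g, hg⟩ : ∃ g : (Fin d → ℝ) →ₗ[ℝ] ℝ, ∀ j ∈ J, g (v j) = -c' j := by
    obtain ⟨g, hg⟩ := LinearMap.exists_extend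
      ((Finsupp.linearCombination ℝ fun j : (J : Set κ) => -c' j) ∘ₗ hJ.repr)
    refine ⟨g, fun j hj => ?_⟩
    have hmem : v j ∈ Submodule.span ℝ (Set.range fun x : (J : Set κ) => v x) :=
      Submodule.subset_span ⟨⟨j, hj⟩, rfl⟩
    have h1 : g (v j) = (g ∘ₗ Submodule.subtype _) ⟨v j, hmem⟩ := rfl
    rw [h1, hg, LinearMap.comp_apply,
      hJ.repr_eq_single ⟨j, hj⟩ ⟨v j, hmem⟩ rfl]
    simp
  have hsign : ∀ j ∉ J, c' j * f (v j) < 0 := by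
    intro j hj
    rw [hcc j hj]
    rcases lt_or_gt_of_ne (hfn j hj) with h | h
    · simp [h]
    · simpa [h.not_gt] using h
  have hsq : ∀ j, c' j * c' j = 1 := by
    intro j
    rcases hc' j with h | h <;> rw [h] <;> norm_num
  -- Off `J` the sign of `f` survives a small perturbation; on `J`, where `f` vanishes, `g` decides.
  have hev : ∀ᶠ ε in 𝓝[>] (0 : ℝ), ∀ j, c' j * (f (v j) + ε * g (v j)) < 0 := by
    rw [eventually_all]
    intro j
    by_cases hj : j ∈ J
    · filter_upwards [self_mem_nhdsWithin] with ε hε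
      rw [hfJ j hj, hg j hj]
      have : c' j * (0 + ε * -c' j) = -ε * (c' j * c' j) := by ring
      rw [this, hsq]
      simpa using hε
    · have hc : ContinuousAt (fun ε : ℝ => c' j * (f (v j) + ε * g (v j))) 0 := by fun_prop
      have := hc.eventually_lt_const (u := 0) (by simpa using hsign j hj)
      exact this.filter_mono nhdsWithin_le_nhds
  obtain ⟨ε, hε⟩ := hev.exists
  set w₀ : Fin d → ℝ := fun i => (f + ε • g) (Pi.single i 1) with hw₀
  have hw₀v : ∀ x : Fin d → ℝ, ∑ i, w₀ i * x i = f x + ε * g x := by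
    intro x
    have := LinearMap.pi_apply_eq_sum_univ (f + ε • g) x
    rw [LinearMap.add_apply, LinearMap.smul_apply, smul_eq_mul] at this
    rw [this]
    refine Finset.sum_congr rfl fun i _ => ?_
    have hi : (fun k => if i = k then (1 : ℝ) else 0) = Pi.single i 1 := by
      ext k
      simp [Pi.single_apply, eq_comm]
    rw [smul_eq_mul, mul_comm, hi]
  -- A further small shift of all the weights makes each nonzero without disturbing the strict
  -- inequalities.
  have hev1 : ∀ᶠ δ in 𝓝[>] (0 : ℝ), ∀ i, w₀ i + δ ≠ 0 := by
    rw [eventually_all]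
    intro i
    by_cases hi : w₀ i = 0
    · filter_upwards [self_mem_nhdsWithin] with δ hδ
      rw [hi, zero_add]
      exact ne_of_gt hδ
    · have hc : ContinuousAt (fun δ : ℝ => w₀ i + δ) 0 := by fun_prop
      exact (hc.eventually_ne (by simpa using hi)).filter_mono nhdsWithin_le_nhds
  have hev2 : ∀ᶠ δ in 𝓝[>] (0 : ℝ), ∀ j, c' j * ∑ i, (w₀ i + δ) * v j i < 0 := by
    rw [eventually_all]
    intro j
    have hc : ContinuousAt (fun δ : ℝ => c' j * ∑ i, (w₀ i + δ) * v j i) 0 := by fun_prop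
    have := hc.eventually_lt_const (u := 0) (by simpa [hw₀v] using hε j)
    exact this.filter_mono nhdsWithin_le_nhds
  obtain ⟨δ, h1, h2⟩ := (hev1.and hev2).exists
  exact ⟨fun i => w₀ i + δ, h1, h2⟩

/-! ### Separability under random switching -/

/-- The matrices all of whose columns lie in a common open half-space with a positive inner
conormal. -/
def separable (d : ℕ) (κ : Type*) : Set (Fin d × κ → ℝ) :=
  {M | ∃ w : Fin d → ℝ, (∀ i, 0 < w i) ∧ ∀ j, ∑ i, w i * M (i, j) < 0}

theorem isOpen_separable (d : ℕ) (κ : Type*) [Finite κ] : IsOpen (separable d κ) := by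
  have : separable d κ = ⋃ w ∈ {w : Fin d → ℝ | ∀ i, 0 < w i},
      ⋂ j, {M : Fin d × κ → ℝ | ∑ i, w i * M (i, j) < 0} := by
    ext M
    simp [separable]
  rw [this]
  refine isOpen_biUnion fun w _ => isOpen_iInter_of_finite fun j => ?_
  exact isOpen_lt (by fun_prop) continuous_const

/-- The sign vector that is `-1` exactly on `s`. -/
def signOf {α : Type*} [DecidableEq α] (s : Finset α) (a : α) : ℝ := if a ∈ s then -1 else 1

theorem signOf_eq {α : Type*} [DecidableEq α] (s : Finset α) (a : α) :
    signOf s a = 1 ∨ signOf s a = -1 := by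
  unfold signOf
  split_ifs <;> simp

/-- The entrywise signs of a matrix with `m + 1` columns obtained by switching the rows in `t` and
the columns in `s`, the first column being left alone. -/
def flipSign {d m : ℕ} (t : Finset (Fin d)) (s : Finset (Fin m)) (z : Fin d × Fin (m + 1)) : ℝ :=
  signOf t z.1 * (Fin.cons 1 (signOf s) : Fin (m + 1) → ℝ) z.2

open Classical in
theorem sum_choose_le_card_flips {d m : ℕ} (M : Fin d × Fin (m + 1) → ℝ)
    (hM : ∀ J : Finset (Fin (m + 1)), J.card ≤ d →
      LinearIndepOn ℝ (fun j i => M (i, j)) (J : Set (Fin (m + 1)))) :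
    ∑ k ∈ Finset.range d, m.choose k ≤
      (Finset.univ.filter fun x : Finset (Fin d) × Finset (Fin m) =>
        (fun z => flipSign x.1 x.2 z * M z) ∈ separable d (Fin (m + 1))).card := by
  set 𝒜 : Finset (Finset (Fin m)) := Finset.univ.filter fun s =>
    ∃ t : Finset (Fin d), (fun z => flipSign t s z * M z) ∈ separable d (Fin (m + 1)) with h𝒜
  have h1 : 𝒜.card ≤ (Finset.univ.filter fun x : Finset (Fin d) × Finset (Fin m) =>
        (fun z => flipSign x.1 x.2 z * M z) ∈ separable d (Fin (m + 1))).card := by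
    refine (Finset.card_le_card (t := Finset.image Prod.snd _) fun s hs => ?_).trans
      Finset.card_image_le
    obtain ⟨t, ht⟩ := (Finset.mem_filter.1 hs).2
    exact Finset.mem_image.2 ⟨(t, s), Finset.mem_filter.2 ⟨Finset.mem_univ _, ht⟩, rfl⟩
  refine le_trans ?_ h1
  have h2 := card_filter_card_lt (α := Fin m) d
  rw [Fintype.card_fin] at h2
  rw [← h2]
  refine card_le_card_of_stronglyShatters _ _ fun J hJ => ?_
  have hJc : J.card < d := (Finset.mem_filter.1 hJ).2
  set K : Finset (Fin (m + 1)) := J.map (Fin.succEmb m) with hK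
  have hKc : K.card = J.card := Finset.card_map _
  have h0K : (0 : Fin (m + 1)) ∉ K := by simp [hK, Fin.succ_ne_zero]
  -- Since `K` has fewer than `d` elements, it stays within the independence range when one more
  -- column is added.
  obtain ⟨c, hc0, hc, H⟩ := exists_weights_of_linearIndepOn (fun j i => M (i, j)) K
    (fun j hj => by
      have := hM (insert j K) (by rw [Finset.card_insert_of_notMem hj]; omega)
      rwa [Finset.coe_insert] at this)
    (hM K (by omega)) 0 h0K
  refine ⟨Finset.univ.filter fun j => c j.succ = -1, fun t ht => ?_⟩
  set s := (Finset.univ.filter fun j : Fin m => c j.succ = -1) \ J ∪ t with hs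
  obtain ⟨w, hw, hwc⟩ := H (Fin.cons 1 (signOf s) : Fin (m + 1) → ℝ)
    (fun j => by
      refine Fin.cases ?_ (fun j => ?_) j
      · exact Or.inl rfl
      · exact signOf_eq s j)
    (fun j => by
      refine Fin.cases ?_ (fun j => ?_) j
      · exact fun _ => hc0.symm
      · intro hj
        have hjJ : j ∉ J := fun h => hj (Finset.mem_map.2 ⟨j, h, rfl⟩)
        have hjt : j ∉ t := fun h => hjJ (ht h)
        rw [Fin.cons_succ, signOf]
        rcases hc j.succ with h | h
        · rw [if_neg, h]
          simp only [hs, Finset.mem_union, Finset.mem_sdiff, Finset.mem_filter, h]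
          norm_num [hjt]
        · rw [if_pos, h]
          simp [hs, h, hjJ])
  -- Switching the rows of negative weight lets `|w|` replace `w`.
  refine Finset.mem_filter.2 ⟨Finset.mem_univ _, Finset.univ.filter fun i => w i < 0,
    fun i => |w i|, fun i => abs_pos.2 (hw i), fun j => ?_⟩
  refine lt_of_eq_of_lt ?_ (hwc j)
  rw [Finset.mul_sum]
  refine Finset.sum_congr rfl fun i _ => ?_
  have : |w i| * signOf (Finset.univ.filter fun i => w i < 0) i = w i := by
    unfold signOf
    by_cases h : w i < 0
    · simp [h, abs_of_neg h]
    · simp [h, abs_of_nonneg (not_lt.1 h)]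
  simp only [flipSign]
  calc _ = (Fin.cons 1 (signOf s) : Fin (m + 1) → ℝ) j *
        ((|w i| * signOf (Finset.univ.filter fun i => w i < 0) i) * M (i, j)) := by ring
    _ = _ := by rw [this]

theorem identDistrib_sign_mul {Ω ι : Type*} [MeasurableSpace Ω] [Finite ι] {P : Measure Ω}
    {X : ι → Ω → ℝ} (hX : ∀ i, AEMeasurable (X i) P) (hindep : iIndepFun X P)
    (hsymm : ∀ i, IdentDistrib (X i) (fun ω => -X i ω) P P)
    (ε : ι → ℝ) (hε : ∀ i, ε i = 1 ∨ ε i = -1) :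
    IdentDistrib (fun ω i => ε i * X i ω) (fun ω i => X i ω) P P := by
  refine IdentDistrib.pi (X := fun i ω => ε i * X i ω) (fun i => ?_)
    (hindep.comp (fun i x => ε i * x) fun i => measurable_const_mul _) hindep
  rcases hε i with h | h
  · simpa [h] using IdentDistrib.refl (hX i)
  · simpa [h] using (hsymm i).symm

-- All `2 ^ (m + d)` switched matrices have the same law, so the right side is the expected number
-- of separable ones, which the deterministic count bounds below almost surely.
open Classical in
theorem sum_choose_le_prob_separable {Ω : Type*} [MeasurableSpace Ω] {P : Measure Ω}
    [IsProbabilityMeasure P] {d m : ℕ} {X : Fin d × Fin (m + 1) → Ω → ℝ}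
    (hX : ∀ i, AEMeasurable (X i) P) (hindep : iIndepFun X P)
    (hatom : ∀ i, NullSingletonClass (P.map (X i)))
    (hsymm : ∀ i, IdentDistrib (X i) (fun ω => -X i ω) P P) :
    ∑ k ∈ Finset.range d, (m.choose k : ℝ) ≤
      2 ^ (m + d) * P.real {ω | (fun z => X z ω) ∈ separable d (Fin (m + 1))} := by
  set G := separable d (Fin (m + 1)) with hG
  have hGm : MeasurableSet G := (isOpen_separable _ _).measurableSet
  let E : Finset (Fin d) × Finset (Fin m) → Set Ω := fun x =>
    {ω | (fun z => flipSign x.1 x.2 z * X z ω) ∈ G}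
  have hid := fun x : Finset (Fin d) × Finset (Fin m) =>
    identDistrib_sign_mul hX hindep hsymm (flipSign x.1 x.2) fun z => by
      unfold flipSign
      have h1 := signOf_eq x.1 z.1
      have h2 : (Fin.cons 1 (signOf x.2) : Fin (m + 1) → ℝ) z.2 = 1 ∨
          (Fin.cons 1 (signOf x.2) : Fin (m + 1) → ℝ) z.2 = -1 :=
        Fin.cases (Or.inl rfl) (fun j => signOf_eq x.2 j) z.2
      rcases h1 with h1 | h1 <;> rcases h2 with h2 | h2 <;> rw [h1, h2] <;> norm_num
  have hEm : ∀ x, NullMeasurableSet (E x) P := fun x =>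
    (hid x).aemeasurable_fst.nullMeasurable hGm
  have hEP : ∀ x, P.real (E x) = P.real {ω | (fun z => X z ω) ∈ G} := fun x =>
    congrArg ENNReal.toReal ((hid x).measure_mem_eq hGm)
  have hint : ∀ x ∈ (Finset.univ : Finset (Finset (Fin d) × Finset (Fin m))),
      Integrable ((E x).indicator fun _ => (1 : ℝ)) P := fun x _ =>
    (integrable_const 1).indicator₀ (hEm x)
  have hsum : ∫ ω, ∑ x, (E x).indicator (fun _ => (1 : ℝ)) ω ∂P =
      2 ^ (m + d) * P.real {ω | (fun z => X z ω) ∈ G} := by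
    rw [integral_finsetSum _ hint]
    have : ∀ x, ∫ ω, (E x).indicator (fun _ => (1 : ℝ)) ω ∂P =
        P.real {ω | (fun z => X z ω) ∈ G} := by
      intro x
      rw [integral_indicator₀ (hEm x), setIntegral_const, smul_eq_mul, mul_one, hEP]
    rw [Finset.sum_congr rfl fun x _ => this x, Finset.sum_const, nsmul_eq_mul]
    simp [pow_add, mul_comm]
  rw [← hsum]
  calc ∑ k ∈ Finset.range d, (m.choose k : ℝ)
      = ∫ _, ∑ k ∈ Finset.range d, (m.choose k : ℝ) ∂P := by simp
    _ ≤ _ := by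
      refine integral_mono_ae (integrable_const _) (integrable_finsetSum _ hint) ?_
      filter_upwards [ae_linearIndepOn_col hX hindep hatom] with ω hω
      have := sum_choose_le_card_flips (fun z => X z ω) hω
      have h2 : ∑ x, (E x).indicator (fun _ => (1 : ℝ)) ω =
          ((Finset.univ.filter fun x : Finset (Fin d) × Finset (Fin m) =>
            (fun z => flipSign x.1 x.2 z * X z ω) ∈ separable d (Fin (m + 1))).card : ℝ) := by
        rw [Finset.card_filter, Nat.cast_sum]
        refine Finset.sum_congr rfl fun x _ => ?_
        simp [Set.indicator_apply, E, hG]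
      show _ ≤ ∑ x, (E x).indicator (fun _ => (1 : ℝ)) ω
      rw [h2]
      exact_mod_cast this

/-! ### Measurability of the Pareto count -/

theorem finite_zeroOneCube (n : ℕ) : (zeroOneCube n).Finite := by
  have : (Set.pi Set.univ fun _ : Fin n => ({0, 1} : Set ℝ)).Finite :=
    Set.Finite.pi fun _ => Set.toFinite _
  exact this.subset fun x hx j _ => hx j

/-- The feasible `r` whose objective vector is Pareto optimal. -/
def paretoSolutions {d n : ℕ} (S : Set (Fin n → ℝ)) (V : Matrix (Fin d) (Fin n) ℝ) :
    Set (Fin n → ℝ) :=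
  {r | r ∈ S ∧ ∀ s ∈ S, ¬ Dominates (V *ᵥ s) (V *ᵥ r)}

theorem paretoOptima_objectiveVectors {d n : ℕ} (S : Set (Fin n → ℝ))
    (V : Matrix (Fin d) (Fin n) ℝ) :
    paretoOptima (objectiveVectors V S) = (V *ᵥ ·) '' paretoSolutions S V := by
  ext x
  constructor
  · rintro ⟨⟨r, hr, rfl⟩, h⟩
    exact ⟨r, ⟨hr, fun s hs => h _ ⟨s, hs, rfl⟩⟩, rfl⟩
  · rintro ⟨r, ⟨hr, h⟩, rfl⟩
    refine ⟨⟨r, hr, rfl⟩, ?_⟩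
    rintro _ ⟨s, hs, rfl⟩
    exact h s hs

/-- Choosing one solution per optimum expresses the count through finitely many comparisons of
objective vectors, which serves both measurability and lower bounds. -/
theorem le_paretoCount_iff {d n : ℕ} {S : Set (Fin n → ℝ)} (hS : S.Finite)
    (V : Matrix (Fin d) (Fin n) ℝ) (k : ℕ) :
    k ≤ paretoCount (objectiveVectors V S) ↔
      ∃ T ∈ {T : Set (Fin n → ℝ) | T ⊆ S ∧ T.ncard = k},
        (∀ r ∈ T, ∀ s ∈ S, ¬ Dominates (V *ᵥ s) (V *ᵥ r)) ∧
        ∀ r ∈ T, ∀ s ∈ T, r ≠ s → V *ᵥ r ≠ V *ᵥ s := by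
  have hfin : (paretoSolutions S V).Finite := hS.subset fun r hr => hr.1
  rw [paretoCount, paretoOptima_objectiveVectors]
  constructor
  · intro h
    obtain ⟨U, hU, hUk⟩ := Set.exists_subset_card_eq h
    obtain ⟨T, hT, hinj, rfl⟩ := Set.SurjOn.exists_subset_injOn_image_eq
      (f := (V *ᵥ ·)) (s := paretoSolutions S V) (t := U) hU
    refine ⟨T, ⟨fun r hr => (hT hr).1, ?_⟩, fun r hr => (hT hr).2,
      fun r hr s hs hne he => hne (hinj hr hs he)⟩
    rw [← hUk, hinj.ncard_image]
  · rintro ⟨T, ⟨hTS, rfl⟩, hT, hinj⟩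
    have hi : Set.InjOn (V *ᵥ ·) T := fun r hr s hs he => by
      by_contra hne
      exact hinj r hr s hs hne he
    rw [← hi.ncard_image]
    exact Set.ncard_le_ncard (Set.image_mono fun r hr => ⟨hTS hr, hT r hr⟩) (hfin.image _)

theorem measurable_paretoCount {d n : ℕ} {S : Set (Fin n → ℝ)} (hS : S.Finite) :
    Measurable fun M : Fin d × Fin n → ℝ =>
      paretoCount (objectiveVectors (Matrix.of fun i j => M (i, j)) S) := by
  have hmv : ∀ (r : Fin n → ℝ) (i : Fin d), Measurable fun M : Fin d × Fin n → ℝ =>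
      ((Matrix.of fun i j => M (i, j)) *ᵥ r) i := by
    intro r i
    simp only [Matrix.mulVec, dotProduct, Matrix.of_apply]
    fun_prop
  refine measurable_of_Ici fun k => ?_
  have : (fun M : Fin d × Fin n → ℝ =>
      paretoCount (objectiveVectors (Matrix.of fun i j => M (i, j)) S)) ⁻¹' Set.Ici k =
      {M | ∃ T ∈ {T : Set (Fin n → ℝ) | T ⊆ S ∧ T.ncard = k},
        (∀ r ∈ T, ∀ s ∈ S, ¬ Dominates ((Matrix.of fun i j => M (i, j)) *ᵥ s)
          ((Matrix.of fun i j => M (i, j)) *ᵥ r)) ∧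
        ∀ r ∈ T, ∀ s ∈ T, r ≠ s → (Matrix.of fun i j => M (i, j)) *ᵥ r ≠
          (Matrix.of fun i j => M (i, j)) *ᵥ s} := by
    ext M
    exact le_paretoCount_iff hS _ k
  rw [this]
  have hfam : {T : Set (Fin n → ℝ) | T ⊆ S ∧ T.ncard = k}.Finite :=
    hS.finite_subsets.subset fun T hT => hT.1
  have hdom : ∀ r s : Fin n → ℝ, MeasurableSet {M : Fin d × Fin n → ℝ |
      ¬ Dominates ((Matrix.of fun i j => M (i, j)) *ᵥ s)
          ((Matrix.of fun i j => M (i, j)) *ᵥ r)} := by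
    intro r s
    have : {M : Fin d × Fin n → ℝ | ¬ Dominates ((Matrix.of fun i j => M (i, j)) *ᵥ s)
          ((Matrix.of fun i j => M (i, j)) *ᵥ r)} =
        ((⋂ i, {M | ((Matrix.of fun i j => M (i, j)) *ᵥ r) i ≤
          ((Matrix.of fun i j => M (i, j)) *ᵥ s) i}) ∩
        ⋃ i, {M | ((Matrix.of fun i j => M (i, j)) *ᵥ r) i <
          ((Matrix.of fun i j => M (i, j)) *ᵥ s) i})ᶜ := by
      ext M
      simp only [Dominates, Set.mem_ofPred_eq, Set.mem_compl_iff, Set.mem_inter_iff,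
        Set.mem_iInter, Set.mem_iUnion]
    rw [this]
    exact ((MeasurableSet.iInter fun i => measurableSet_le (hmv r i) (hmv s i)).inter
      (MeasurableSet.iUnion fun i => measurableSet_lt (hmv r i) (hmv s i))).compl
  have hne : ∀ r s : Fin n → ℝ, MeasurableSet {M : Fin d × Fin n → ℝ |
      (Matrix.of fun i j => M (i, j)) *ᵥ r ≠ (Matrix.of fun i j => M (i, j)) *ᵥ s} := by
    intro r s
    exact (measurableSet_eq_fun (measurable_pi_lambda _ (hmv r))
      (measurable_pi_lambda _ (hmv s))).compl
  have hrw : {M : Fin d × Fin n → ℝ | ∃ T ∈ {T : Set (Fin n → ℝ) | T ⊆ S ∧ T.ncard = k},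
        (∀ r ∈ T, ∀ s ∈ S, ¬ Dominates ((Matrix.of fun i j => M (i, j)) *ᵥ s)
          ((Matrix.of fun i j => M (i, j)) *ᵥ r)) ∧
        ∀ r ∈ T, ∀ s ∈ T, r ≠ s → (Matrix.of fun i j => M (i, j)) *ᵥ r ≠
          (Matrix.of fun i j => M (i, j)) *ᵥ s} =
      ⋃ T ∈ {T : Set (Fin n → ℝ) | T ⊆ S ∧ T.ncard = k},
        (⋂ r ∈ T, ⋂ s ∈ S, {M | ¬ Dominates ((Matrix.of fun i j => M (i, j)) *ᵥ s)
          ((Matrix.of fun i j => M (i, j)) *ᵥ r)}) ∩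
        ⋂ r ∈ T, ⋂ s ∈ T, ⋂ _ : r ≠ s, {M | (Matrix.of fun i j => M (i, j)) *ᵥ r ≠
          (Matrix.of fun i j => M (i, j)) *ᵥ s} := by
    ext M
    simp only [Set.mem_ofPred_eq, Set.mem_iUnion, Set.mem_inter_iff, Set.mem_iInter, exists_prop]
  rw [hrw]
  refine hfam.measurableSet_biUnion fun T hT => ?_
  have hTf : T.Finite := hS.subset hT.1
  refine MeasurableSet.inter ?_ ?_
  · exact hTf.measurableSet_biInter fun r _ => hS.measurableSet_biInter fun s _ => hdom r s
  · exact hTf.measurableSet_biInter fun r _ => hTf.measurableSet_biInter fun s _ =>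
      MeasurableSet.iInter fun _ => hne r s

theorem paretoCount_objectiveVectors_le {d n : ℕ} {S : Set (Fin n → ℝ)} (hS : S.Finite)
    (V : Matrix (Fin d) (Fin n) ℝ) : paretoCount (objectiveVectors V S) ≤ S.ncard := by
  obtain ⟨T, ⟨hT, hk⟩, -⟩ := (le_paretoCount_iff hS V _).1 le_rfl
  rw [← hk]
  exact Set.ncard_le_ncard hT hS

/-! ### From separability to Pareto optima -/

/-- If the columns, switched at the ones of `r`, are positively separable, then some positive
weighting of the objectives is maximized over the cube at `r` only. -/
theorem exists_weights_sum_lt {d n : ℕ} {V : Matrix (Fin d) (Fin n) ℝ} {r : Fin n → ℝ}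
    (hr : r ∈ zeroOneCube n)
    (h : (fun z : Fin d × Fin n => (1 - 2 * r z.2) * V z.1 z.2) ∈ separable d (Fin n)) :
    ∃ w : Fin d → ℝ, (∀ i, 0 < w i) ∧ ∀ s ∈ zeroOneCube n, s ≠ r →
      ∑ i, w i * (V *ᵥ s) i < ∑ i, w i * (V *ᵥ r) i := by
  obtain ⟨w, hw, hneg⟩ := h
  refine ⟨w, hw, fun s hs hne => ?_⟩
  have hcomb : ∀ x : Fin n → ℝ, ∑ i, w i * (V *ᵥ x) i = ∑ j, x j * ∑ i, w i * V i j := by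
    intro x
    simp only [Matrix.mulVec, dotProduct, Finset.mul_sum]
    rw [Finset.sum_comm]
    exact Finset.sum_congr rfl fun j _ => Finset.sum_congr rfl fun i _ => by ring
  have hneg' : ∀ j, (1 - 2 * r j) * ∑ i, w i * V i j < 0 := by
    intro j
    refine lt_of_eq_of_lt ?_ (hneg j)
    rw [Finset.mul_sum]
    exact Finset.sum_congr rfl fun i _ => by ring
  rw [hcomb, hcomb]
  have hlt : ∀ j, s j ≠ r j → s j * ∑ i, w i * V i j < r j * ∑ i, w i * V i j := by
    intro j hj
    have := hneg' j
    rcases hr j with h1 | h1 <;> rcases hs j with h2 | h2 <;> rw [h1, h2] at hj <;>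
      rw [h1] at this <;> rw [h1, h2]
    · exact absurd rfl hj
    · linarith
    · linarith
    · exact absurd rfl hj
  obtain ⟨j, hj⟩ := Function.ne_iff.1 hne
  refine Finset.sum_lt_sum (fun j _ => ?_) ⟨j, Finset.mem_univ _, hlt j hj⟩
  by_cases h : s j = r j
  · rw [h]
  · exact (hlt j h).le

-- A dominating point would have at least the same positively weighted value, contradicting unique
-- maximality; uniqueness also keeps the objective vectors distinct.
open Classical in
theorem card_separable_le_paretoCount {d n : ℕ} {S : Finset (Fin n → ℝ)}
    (hS : (S : Set (Fin n → ℝ)) ⊆ zeroOneCube n) (V : Matrix (Fin d) (Fin n) ℝ) :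
    (S.filter fun r => (fun z : Fin d × Fin n => (1 - 2 * r z.2) * V z.1 z.2) ∈
      separable d (Fin n)).card ≤ paretoCount (objectiveVectors V (S : Set (Fin n → ℝ))) := by
  refine (le_paretoCount_iff S.finite_toSet V _).2
    ⟨_, ⟨Finset.coe_subset.2 (Finset.filter_subset _ _), Set.ncard_coe_finset _⟩, ?_, ?_⟩
  · intro r hr s hs hdom
    obtain ⟨hrS, hr⟩ := Finset.mem_filter.1 hr
    obtain ⟨w, hw, hlt⟩ := exists_weights_sum_lt (hS hrS) hr
    by_cases hsr : s = r
    · subst hsr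
      obtain ⟨i, hi⟩ := hdom.2
      exact lt_irrefl _ hi
    · refine (hlt s (hS hs) hsr).not_ge ?_
      exact Finset.sum_le_sum fun i _ => mul_le_mul_of_nonneg_left (hdom.1 i) (hw i).le
  · intro r hr s hs hne he
    obtain ⟨hrS, hr⟩ := Finset.mem_filter.1 hr
    obtain ⟨w, hw, hlt⟩ := exists_weights_sum_lt (hS hrS) hr
    have := hlt s (hS (Finset.mem_filter.1 hs).1) hne.symm
    rw [he] at this
    exact lt_irrefl _ this

theorem integrable_paretoCount_and_le_integral {Ω : Type*} [MeasurableSpace Ω]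
    (P : Measure Ω) [IsProbabilityMeasure P]
    (d n : ℕ) (hn : 1 ≤ n)
    (V : Ω → Matrix (Fin d) (Fin n) ℝ)
    (hindep : iIndepFun (fun (ij : Fin d × Fin n) (ω : Ω) => V ω ij.1 ij.2) P)
    (hdensity : ∀ i j, HasPDF (fun ω => V ω i j) P (volume : Measure ℝ))
    (hsymm : ∀ i j, IdentDistrib (fun ω => V ω i j) (fun ω => -V ω i j) P P)
    (T : Finset (Fin n → ℝ)) (hS : (T : Set (Fin n → ℝ)) ⊆ zeroOneCube n) :
    Integrable
        (fun ω => (paretoCount (objectiveVectors (V ω) (T : Set (Fin n → ℝ))) : ℝ)) P ∧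
      ((T : Set (Fin n → ℝ)).ncard : ℝ) / 2 ^ (n + d - 1) *
          ∑ k ∈ Finset.range d, ((n - 1).choose k : ℝ) ≤
        ∫ ω, (paretoCount (objectiveVectors (V ω) (T : Set (Fin n → ℝ))) : ℝ) ∂P := by
  classical
  have hSf : (T : Set (Fin n → ℝ)).Finite := T.finite_toSet
  set X : Fin d × Fin n → Ω → ℝ := fun z ω => V ω z.1 z.2 with hXdef
  have hX : ∀ z, AEMeasurable (X z) P := fun z => (hdensity z.1 z.2).aemeasurable'
  have hsymm' : ∀ z, IdentDistrib (X z) (fun ω => -X z ω) P P := fun z => hsymm z.1 z.2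
  -- Of the densities, only the absence of atoms matters beyond this point.
  have hatom : ∀ z, NullSingletonClass (P.map (X z)) := fun z =>
    ⟨fun x => (hdensity z.1 z.2).absolutelyContinuous' (measure_singleton x)⟩
  have hcount : AEMeasurable
      (fun ω => paretoCount (objectiveVectors (V ω) (T : Set (Fin n → ℝ)))) P := by
    have h := (measurable_paretoCount (d := d) hSf).comp_aemeasurable
      (aemeasurable_pi_lambda (fun ω z => X z ω) hX)
    have hV : ∀ ω, (Matrix.of fun i j => X (i, j) ω) = V ω := fun _ => rfl
    simpa only [Function.comp_def, hV] using h
  have hint : Integrable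
      (fun ω => (paretoCount (objectiveVectors (V ω) (T : Set (Fin n → ℝ))) : ℝ)) P := by
    refine Integrable.of_bound (measurable_from_top.comp_aemeasurable hcount).aestronglyMeasurable
      ((T : Set (Fin n → ℝ)).ncard : ℝ) (Filter.Eventually.of_forall fun ω => ?_)
    rw [Real.norm_natCast]
    exact_mod_cast paretoCount_objectiveVectors_le hSf (V ω)
  refine ⟨hint, ?_⟩
  set G := separable d (Fin n) with hG
  have hGm : MeasurableSet G := (isOpen_separable _ _).measurableSet
  have hprob : ∑ k ∈ Finset.range d, ((n - 1).choose k : ℝ) ≤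
      2 ^ (n + d - 1) * P.real {ω | (fun z => X z ω) ∈ G} := by
    obtain ⟨m, rfl⟩ : ∃ m, n = m + 1 := ⟨n - 1, by omega⟩
    rw [show m + 1 + d - 1 = m + d by omega, Nat.add_sub_cancel]
    exact sum_choose_le_prob_separable hX hindep hatom hsymm'
  let E : (Fin n → ℝ) → Set Ω := fun r => {ω | (fun z => (1 - 2 * r z.2) * X z ω) ∈ G}
  -- On the cube `1 - 2 * r j` is a sign, so every `E r` has the probability of the unswitched
  -- event.
  have hid : ∀ r ∈ T, IdentDistrib (fun ω z => (1 - 2 * r z.2) * X z ω) (fun ω z => X z ω) P P :=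
    fun r hr => identDistrib_sign_mul hX hindep hsymm' (fun z => 1 - 2 * r z.2) fun z => by
      rcases hS hr z.2 with h | h <;> rw [h] <;> norm_num
  have hEm : ∀ r ∈ T, NullMeasurableSet (E r) P := fun r hr =>
    (hid r hr).aemeasurable_fst.nullMeasurable hGm
  have hEint : ∀ r ∈ T, Integrable ((E r).indicator fun _ => (1 : ℝ)) P := fun r hr =>
    (integrable_const 1).indicator₀ (hEm r hr)
  calc ((T : Set (Fin n → ℝ)).ncard : ℝ) / 2 ^ (n + d - 1) *
        ∑ k ∈ Finset.range d, ((n - 1).choose k : ℝ)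
      ≤ (T.card : ℝ) / 2 ^ (n + d - 1) *
        (2 ^ (n + d - 1) * P.real {ω | (fun z => X z ω) ∈ G}) := by
        rw [Set.ncard_coe_finset]
        exact mul_le_mul_of_nonneg_left hprob (by positivity)
    _ = T.card * P.real {ω | (fun z => X z ω) ∈ G} := by field_simp
    _ = ∫ ω, ∑ r ∈ T, (E r).indicator (fun _ => (1 : ℝ)) ω ∂P := by
        rw [integral_finsetSum _ hEint, ← nsmul_eq_mul, ← Finset.sum_const]
        refine Finset.sum_congr rfl fun r hr => ?_
        rw [integral_indicator₀ (hEm r hr), setIntegral_const, smul_eq_mul, mul_one]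
        exact congrArg ENNReal.toReal ((hid r hr).measure_mem_eq hGm).symm
    _ ≤ _ := by
        refine integral_mono (integrable_finsetSum _ hEint) hint fun ω => ?_
        have h2 : ∑ r ∈ T, (E r).indicator (fun _ => (1 : ℝ)) ω =
            ((T.filter fun r => (fun z : Fin d × Fin n => (1 - 2 * r z.2) * V ω z.1 z.2) ∈
              separable d (Fin n)).card : ℝ) := by
          rw [Finset.card_filter, Nat.cast_sum]
          refine Finset.sum_congr rfl fun x _ => ?_
          simp [Set.indicator_apply, E, hG, hXdef]
        show ∑ r ∈ T, (E r).indicator (fun _ => (1 : ℝ)) ω ≤ _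
        rw [h2]
        exact_mod_cast card_separable_le_paretoCount hS (V ω)

end SmoothedPareto

theorem mainTheorem5 {Ω : Type*} [MeasurableSpace Ω] (P : Measure Ω) [IsProbabilityMeasure P]
    (d n : ℕ) (hd : 1 ≤ d) (hn : 1 ≤ n)
    (V : Ω → Matrix (Fin d) (Fin n) ℝ)
    (hindep : iIndepFun (fun (ij : Fin d × Fin n) (ω : Ω) => V ω ij.1 ij.2) P)
    (hdensity : ∀ i j, HasPDF (fun ω => V ω i j) P (volume : Measure ℝ))
    (hsymm : ∀ i j, IdentDistrib (fun ω => V ω i j) (fun ω => -V ω i j) P P)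
    (S : Set (Fin n → ℝ)) (hS : S ⊆ SmoothedPareto.zeroOneCube n) :
    Integrable
        (fun ω => (SmoothedPareto.paretoCount (SmoothedPareto.objectiveVectors (V ω) S) : ℝ)) P ∧
      (S.ncard : ℝ) / 2 ^ (n + d - 1) * ∑ k ∈ Finset.range d, ((n - 1).choose k : ℝ) ≤
        ∫ ω, (SmoothedPareto.paretoCount (SmoothedPareto.objectiveVectors (V ω) S) : ℝ) ∂P := by
  obtain ⟨T, rfl⟩ := ((SmoothedPareto.finite_zeroOneCube n).subset hS).exists_finset_coe
  exact SmoothedPareto.integrable_paretoCount_and_le_integral P d n hn V hindep hdensity hsymm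
    T hS
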